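/- **Setting.** Let $\ell,n_{\min}\ge 1$, $p\ge 0$, $n=2^{\ell}n_{\min}$, and let $\{1,\dots,n\}$ be bisected recursively $\ell$ times into consecutive halves; the $2^k$ index sets of level $k$ have size $n/2^k$. A *sibling block* of level $k$ ($1\le k\le \ell$) of an $n\times n$ matrix is an off-diagonal block whose rows and columns belong to the two halves of one index set of level $k-1$. A matrix is a $p$-HODLR matrix if all its sibling blocks have rank at most $p$ (for a diagonal block of level $k$, only the sibling blocks inside it count). Floating-point arithmetic follows the standard model: an operation, or a conversion, in precision $v$ returns the exact value times $1+\eta$ with $|\eta|\le v$. Let $0<u$ be the working precision, $\varepsilon>0$, and $\gamma_k=ku/(1-ku)$. **Construction of $\widehat H$.** Let $H\in\mathbb R^{n\times n}$ be a $p$-HODLR matrix and $\mathcal U$ a finite set of positive available precisions. For $1\le k\le\ell$ let $\xi_k$ be the maximum of $\|B\|_F/\|H\|_F$ over the sibling blocks $B$ of level $k$ of $H$, and let $u_k$ be the largest $v\in\{u\}\cup\mathcal U$ with $v\le \varepsilon/(2^{k/2}\xi_k)$ (that is, $2^{k/2}\xi_k v\le\varepsilon$). Every sibling block $B$ of level $k$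 is approximated by a truncated singular value decomposition $\widetilde B=\widetilde U\widetilde V^T$ with at most $p$ terms, $\|\widetilde B-B\|_F\le\varepsilon\|B\|_F$, where $\widetilde U$ has columns orthonormal to precision $u$, and $\widetilde V=W\,\mathrm{diag}(\sigma)$, $\sigma\ge 0$, where $W$ has columns orthonormal to precision $u$ (the entries of $\widetilde U^T\widetilde U-I$ and $W^TW-I$ are at most $\kappa u$ in modulus). $\widetilde U$ and $\widetilde V$ are stored entrywise in precision $u_k$, giving $\widehat U,\widehat V$, and the corresponding block of $\widehat H$ is $\widehat U\widehat V^T$. The diagonal blocks of level $\ell$ of $\widehat H$ are those of $H$, stored in precision $u$. **LU factorization.** $\widehat L,\widehat U$ are computed from $\widehat H$ by the recursive HODLR LU algorithm in precision $u$: for a diagonal block of level $k<\ell$, partitioned into $H_{11},H_{12},H_{21},H_{22}$, factorize $H_{11}$ recursively into $L_{11}U_{11}$, solve $L_{11}U_{12}=H_{12}$ and $L_{21}U_{11}=H_{21}$, compute $H_{22}-L_{21}U_{12}$, truncate the result $\widetilde S$ to a $p$-HODLR matrix $\widehat S$, and factorize $\widehat S$ recursively into $L_{22}U_{22}$; the blocks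 of level $\ell$ are factorized by dense Gaussian elimination without pivoting in precision $u$. All pivots by which one divides are nonzero. The following is assumed about the kernels, for blocks of size $q$, with constants $f(q),h(q)$ satisfying $f(q)u\le\gamma_q$ and $h(q)u\le\gamma_q$ for $1\le q\le n$: * truncation: $\|\widehat S-\widetilde S\|_F\le\varepsilon\|\widetilde S\|_F$; * the computed product $\widehat C$ of $A$ and $B$ satisfies $\|\widehat C-AB\|_F\le h(q)u\|A\|_F\|B\|_F$; * the computed solution $\widehat X$ of a triangular system $TX=B$ (or $XT=B$) satisfies $\|T\widehat X-B\|_F\le f(q)u\|T\|_F\|\widehat X\|_F$ (respectively $\|\widehat XT-B\|_F\le f(q)u\|T\|_F\|\widehat X\|_F$). **Meaning of $\lesssim$.** Terms of second order in the small quantities $\varepsilon,u,u_1,\dots,u_\ell$ are dropped: with $\delta=\max(\varepsilon,u_1,\dots,u_\ell)$, $x\lesssim y$ means $x\le(1+c\,\delta)\,y$ with a constant $c$, for all sufficiently small $\delta$. **Corollary.** If $u\lesssim\varepsilon/n$, then $$\widehat L\widehat U=H+\Delta H,\qquad \|\Delta H\|_F\lesssim 2(2^\ell-1)\,\varepsilon\,\|H\|_F+11(2^\ell-1)\,\varepsilon\,\|\widehat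 L\|_F\|\widehat U\|_F .$$ That is: for all $\ell,n_{\min}\ge1$, $p\ge 0$ and $K,\kappa\ge0$ there are $C\ge0$ and $\delta_0>0$, depending only on these, such that in the setting above, whenever $\delta\le\delta_0$ and $u\le(1+K\delta)\,\varepsilon/n$, $$\|\Delta H\|_F\le(1+C\delta)\Bigl(2(2^\ell-1)\varepsilon\|H\|_F+11(2^\ell-1)\varepsilon\|\widehat L\|_F\|\widehat U\|_F\Bigr).$$ -/

import Mathlib

noncomputable section

namespace HODLR

/-! ### Index sets, blocks, norm -/

/-- Index set of a diagonal block whose cluster tree has `d` further levels, for the perfectly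
balanced binary tree with leaves of size `m`: it has `2 ^ d * m` elements, and it is cut into two
consecutive halves.  The whole matrix of an `ℓ`-level format is indexed by `Idx m ℓ`; a diagonal
block of level `k` is indexed by `Idx m (ℓ - k)`. -/
def Idx (m : ℕ) : ℕ → Type
  | 0 => Fin m
  | d + 1 => Idx m d ⊕ Idx m d

instance instFintypeIdx (m : ℕ) : (d : ℕ) → Fintype (Idx m d)
  | 0 => inferInstanceAs (Fintype (Fin m))
  | d + 1 =>
    letI := instFintypeIdx m d
    inferInstanceAs (Fintype (Idx m d ⊕ Idx m d))

/-- Square real matrices over a diagonal block with `d` further levels. -/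
abbrev Mat (m d : ℕ) : Type := Matrix (Idx m d) (Idx m d) ℝ

/-- The four blocks of a matrix with at least one level. -/
def b11 {m d : ℕ} (A : Mat m (d + 1)) : Mat m d := fun i j => A (Sum.inl i) (Sum.inl j)

def b12 {m d : ℕ} (A : Mat m (d + 1)) : Mat m d := fun i j => A (Sum.inl i) (Sum.inr j)

def b21 {m d : ℕ} (A : Mat m (d + 1)) : Mat m d := fun i j => A (Sum.inr i) (Sum.inl j)

def b22 {m d : ℕ} (A : Mat m (d + 1)) : Mat m d := fun i j => A (Sum.inr i) (Sum.inr j)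

/-- Frobenius norm. -/
def frob {α β : Type} [Fintype α] [Fintype β] (A : Matrix α β ℝ) : ℝ :=
  √(∑ i, ∑ j, A i j ^ 2)

/-! ### First-order inequalities -/

/-- `x ≲ y` when all the small quantities of the problem are at most `δ`: the inequality holds up
to a relative perturbation `c * δ`, that is, after terms of second order are dropped. -/
def LeFirstOrder (c δ x y : ℝ) : Prop := x ≤ (1 + c * δ) * y

/-! ### Standard model of floating-point arithmetic -/

/-- `y` is `x` rounded to a precision with unit roundoff `u`. -/
def Rounds (u x y : ℝ) : Prop := ∃ η : ℝ, |η| ≤ u ∧ y = x * (1 + η)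

/-- `B` is the matrix `A`, stored (entry by entry) in a precision with unit roundoff `u`. -/
def Stored {α β : Type} (u : ℝ) (A B : Matrix α β ℝ) : Prop :=
  ∀ i j, Rounds u (A i j) (B i j)

/-- `FlSum u s x`: `x` can be obtained by summing the numbers in `s` in precision `u`, in some
order of evaluation (an arbitrary binary summation tree, one rounding per addition). -/
inductive FlSum (u : ℝ) : Multiset ℝ → ℝ → Prop
  | single (x : ℝ) : FlSum u {x} x
  | add {s t : Multiset ℝ} {x y z : ℝ} :
      FlSum u s x → FlSum u t y → Rounds u (x + y) z → FlSum u (s + t) z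

/-- `γ_n = n u / (1 - n u)`. -/
def gam (u : ℝ) (n : ℕ) : ℝ := n * u / (1 - n * u)

/-- `x` is the value of `a - ∑_{t < r} L i t * U t j`, computed in precision `u` in some order of
evaluation. -/
def FlResidual {m : ℕ} (u a : ℝ) (L U : Matrix (Fin m) (Fin m) ℝ) (i j r : Fin m) (x : ℝ) : Prop :=
  ∃ q : Fin m → ℝ, (∀ t, t < r → Rounds u (L i t * U t j) (q t)) ∧
    FlSum u (a ::ₘ (Finset.univ.filter (fun t : Fin m => t < r)).val.map (fun t => - q t)) x

/-- `L` and `U` are the factors computed by dense LU factorization (Gaussian elimination without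
pivoting) of `A` in precision `u`: every operation is rounded, the order of evaluation of the inner
sums is free, and the pivots by which one divides are nonzero. -/
def DenseLU {m : ℕ} (u : ℝ) (A L U : Matrix (Fin m) (Fin m) ℝ) : Prop :=
  (∀ i, L i i = 1) ∧ (∀ i j, i < j → L i j = 0) ∧ (∀ i j, j < i → U i j = 0) ∧
  (∀ i j, i ≤ j → FlResidual u (A i j) L U i j i (U i j)) ∧
  (∀ i j, j < i → U j j ≠ 0 ∧
    ∃ s, FlResidual u (A i j) L U i j j s ∧ Rounds u (s / U j j) (L i j))

/-! ### HODLR matrices -/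

/-- `(T, p)`-HODLR matrices: all blocks that belong to two siblings have rank at most `p`. -/
def IsHODLR {m : ℕ} (p : ℕ) : (d : ℕ) → Mat m d → Prop
  | 0, _ => True
  | d + 1, H => (b12 H).rank ≤ p ∧ (b21 H).rank ≤ p ∧ IsHODLR p d (b11 H) ∧ IsHODLR p d (b22 H)

/-- `(T, p, ε)`-HODLR matrices `H'` to `H`: the blocks that belong to siblings are approximated
with relative error at most `ε`, and the diagonal blocks of the last level are those of `H`. -/
def IsHODLRApprox {m : ℕ} (ε : ℝ) : (d : ℕ) → Mat m d → Mat m d → Prop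
  | 0, H, H' => H' = H
  | d + 1, H, H' =>
    frob (b12 H' - b12 H) ≤ ε * frob (b12 H) ∧ frob (b21 H' - b21 H) ≤ ε * frob (b21 H) ∧
    IsHODLRApprox ε d (b11 H) (b11 H') ∧ IsHODLRApprox ε d (b22 H) (b22 H')

/-- The largest Frobenius norm of the sibling blocks of level `k`, `1 ≤ k ≤ d`. -/
def offMax {m : ℕ} : (d : ℕ) → Mat m d → ℕ → ℝ
  | 0, _, _ => 0
  | _ + 1, _, 0 => 0
  | _ + 1, H, 1 => max (frob (b12 H)) (frob (b21 H))
  | d + 1, H, k + 2 => max (offMax d (b11 H) (k + 1)) (offMax d (b22 H) (k + 1))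

/-- The columns of `X` are orthonormal to precision `u` (up to a constant multiple `κ` of `u`). -/
def NearlyOrthonormal {α : Type} [Fintype α] {r : ℕ} (κ u : ℝ) (X : Matrix α (Fin r) ℝ) : Prop :=
  ∀ a b, |(X.transpose * X - (1 : Matrix (Fin r) (Fin r) ℝ)) a b| ≤ κ * u

/-- The block `B` has, in precision `u`, been computed as a truncated singular value decomposition
`X * (Y * diag σ)ᵀ` with at most `p` terms; its two factors `X` and `Y * diag σ` have been stored
in precision `v`, and `B'` is the block represented by the stored factors. -/
def StoredLowRank {α : Type} [Fintype α] (p : ℕ) (κ u v : ℝ) (B B' : Matrix α α ℝ) : Prop :=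
  ∃ (r : ℕ) (X Y V X' V' : Matrix α (Fin r) ℝ) (σ : Fin r → ℝ),
    r ≤ p ∧ NearlyOrthonormal κ u X ∧ NearlyOrthonormal κ u Y ∧ (∀ a, 0 ≤ σ a) ∧
    V = Y * Matrix.diagonal σ ∧ B = X * V.transpose ∧
    Stored v X X' ∧ Stored v V V' ∧ B' = X' * V'.transpose

/-- The mixed-precision representation `B` of a matrix `A` in the format, `A` being a diagonal
block of level `k`: sibling blocks of level `j` are stored through low-rank factors in precision
`w j`, the diagonal blocks of the last level are stored in the working precision `u`. -/
def MixedRep {m : ℕ} (p : ℕ) (κ u : ℝ) (w : ℕ → ℝ) : (d : ℕ) → (k : ℕ) → Mat m d → Mat m d → Prop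
  | 0, _, A, B => Stored u A B
  | d + 1, k, A, B =>
    StoredLowRank p κ u (w (k + 1)) (b12 A) (b12 B) ∧
    StoredLowRank p κ u (w (k + 1)) (b21 A) (b21 B) ∧
    MixedRep p κ u w d (k + 1) (b11 A) (b11 B) ∧ MixedRep p κ u w d (k + 1) (b22 A) (b22 B)

/-- `B` is an output of the adaptive-precision HODLR construction for `H` with `ℓ` levels, working
precision `u`, threshold `ε`, set `P` of available precisions.  The precision `w k` of level `k` is
the largest `v ∈ {u} ∪ P` with `v ≤ ε / (2 ^ (k / 2) * ξ_k)`, where `ξ_k` is the largest norm of a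
sibling block of level `k` divided by the norm of `H`; this is written without the quotients. -/
def AdaptiveHODLR {m : ℕ} (p : ℕ) (κ u ε : ℝ) (P : Finset ℝ) (ℓ : ℕ) (H : Mat m ℓ)
    (w : ℕ → ℝ) (B : Mat m ℓ) : Prop :=
  (∀ k, 1 ≤ k → k ≤ ℓ →
    IsGreatest {v : ℝ | v ∈ insert u P ∧ √2 ^ k * offMax ℓ H k * v ≤ ε * frob H} (w k)) ∧
  ∃ H' : Mat m ℓ, IsHODLRApprox ε ℓ H H' ∧ MixedRep p κ u w ℓ 0 H' B

/-! ### The recursive LU factorization -/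

/-- Error assumption on the computed product `C` of `A` and `B`, with constant `c`. -/
def ComputedMul {α : Type} [Fintype α] (c u : ℝ) (A B C : Matrix α α ℝ) : Prop :=
  ∃ E, C = A * B + E ∧ frob E ≤ c * u * frob A * frob B

/-- Error assumption on the computed solution `X` of `T * X = B`, with constant `c`. -/
def ComputedSolveLeft {α : Type} [Fintype α] (c u : ℝ) (T B X : Matrix α α ℝ) : Prop :=
  ∃ E, T * X = B + E ∧ frob E ≤ c * u * frob T * frob X

/-- Error assumption on the computed solution `X` of `X * T = B`, with constant `c`. -/
def ComputedSolveRight {α : Type} [Fintype α] (c u : ℝ) (T B X : Matrix α α ℝ) : Prop :=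
  ∃ E, X * T = B + E ∧ frob E ≤ c * u * frob T * frob X

/-- Rank truncation of the computed Schur complement `S` to the `(T, p)`-HODLR matrix `S'`. -/
def Truncated {m : ℕ} (p : ℕ) (ε : ℝ) (d : ℕ) (S S' : Mat m d) : Prop :=
  IsHODLR p d S' ∧ frob (S' - S) ≤ ε * frob S

/-- `L` and `U` are an output of the recursive HODLR LU factorization of `A` in precision `u`, whose
matrix products, triangular solves and truncations obey the error assumptions.  Dense LU on the
last level and the subtraction in the Schur complement follow the standard model. -/
def HODLRLU {m : ℕ} (f h : ℕ → ℝ) (p : ℕ) (u ε : ℝ) : (d : ℕ) → Mat m d → Mat m d → Mat m d → Prop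
  | 0, A, L, U => DenseLU (m := m) u A L U
  | d + 1, A, L, U =>
    b12 L = 0 ∧ b21 U = 0 ∧
    HODLRLU f h p u ε d (b11 A) (b11 L) (b11 U) ∧
    ComputedSolveLeft (f (2 ^ d * m)) u (b11 L) (b12 A) (b12 U) ∧
    ComputedSolveRight (f (2 ^ d * m)) u (b11 U) (b21 A) (b21 L) ∧
    ∃ Z S S' : Mat m d,
      ComputedMul (h (2 ^ d * m)) u (b21 L) (b12 U) Z ∧
      Stored u (b22 A - Z) S ∧
      Truncated p ε d S S' ∧
      HODLRLU f h p u ε d S' (b22 L) (b22 U)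

end HODLR

end

/-!
Write `Λ = ‖L‖ * ‖U‖` for the computed factors. The error splits into that of the representation,
`Hhat - H`, and that of the factorization, `L * U - Hhat`.

*Representation.* Replacing the sibling blocks by truncated singular value decompositions costs
`ε * ‖H‖`, since the blocks are disjoint. Storing the two factors of a block in precision `v` changes
it by about `2 * v` relative to its norm (`StoredLowRank.frob_sub_le`), and the precision of level `k`
is chosen such that the `2 ^ k` blocks of that level contribute, to first order, at most
`(2 * ε * ‖H‖) ^ 2` to the squared error (`MixedRep.frob_sub_sq_le`). Hence `‖Hhat - H‖ ≤ 4 * ℓ * ε * ‖H‖`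
(`AdaptiveHODLR.frob_sub_le`).

*Factorization.* Dense elimination on the leaves has the error `O(m * u) * Λ`, and `m * u` is of the
order of `ε / 2 ^ ℓ`. In a recursive step the computed Schur complement and its truncation are, to
first order, bounded by the product `‖L₂₂‖ * ‖U₂₂‖` of the factors computed from them. So truncation
and rounding of the Schur complement cost at most `2 * ε * ‖L₂₂‖ * ‖U₂₂‖`, and by Cauchy–Schwarz
(`frob_le_of_blocks`) the constant grows only by `2 * ε` per level:
`‖L * U - Hhat‖ ≤ (5 + 2 * ℓ) * ε * Λ` (`HODLRLU.frob_sub_le`).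

*Combination.* With `N = 2 ^ ℓ - 1 ≥ ℓ` the error is at most `7 * N * ε * Λ + 4 * N * ε * ‖H‖`. Since
`‖H‖ ≤ Λ + ‖L * U - H‖ ≤ 11 / 10 * Λ`, half of the last term can be moved to the first one. The room
left in the constants absorbs all terms of second order, so `C = 0` suffices when `δ₀` is small enough.
-/

namespace HODLR

/-! ### Frobenius norm -/

lemma Stored.abs_sub_le {α β : Type} {u : ℝ} {A B : Matrix α β ℝ} (hAB : Stored u A B)
    (i : α) (j : β) : |(B - A) i j| ≤ u * |A i j| := by
  obtain ⟨η, hη, h⟩ := hAB i j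
  rw [Matrix.sub_apply, h, show A i j * (1 + η) - A i j = η * A i j by ring, abs_mul]
  exact mul_le_mul_of_nonneg_right hη (abs_nonneg _)

section Frobenius

variable {α β ι : Type} [Fintype α] [Fintype β] [Fintype ι]

lemma frob_nonneg (A : Matrix α β ℝ) : 0 ≤ frob A := Real.sqrt_nonneg _

lemma frob_sq (A : Matrix α β ℝ) : frob A ^ 2 = ∑ i, ∑ j, A i j ^ 2 :=
  Real.sq_sqrt (Finset.sum_nonneg fun _ _ => Finset.sum_nonneg fun _ _ => sq_nonneg _)

open scoped Matrix.Norms.Frobenius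

lemma frob_eq_norm (A : Matrix α β ℝ) : frob A = ‖A‖ := by
  rw [Matrix.frobenius_norm_def, frob, Real.sqrt_eq_rpow]
  simp

lemma frob_add_le (A B : Matrix α β ℝ) : frob (A + B) ≤ frob A + frob B := by
  simp only [frob_eq_norm]
  exact norm_add_le _ _

lemma frob_sub_comm (A B : Matrix α β ℝ) : frob (A - B) = frob (B - A) := by
  simp only [frob_eq_norm]
  exact norm_sub_rev _ _

lemma frob_neg (A : Matrix α β ℝ) : frob (-A) = frob A := by
  simp only [frob_eq_norm]
  exact norm_neg _

lemma frob_le_add_sub (A B : Matrix α β ℝ) : frob A ≤ frob B + frob (A - B) := by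
  simpa using frob_add_le B (A - B)

lemma frob_mul_le (A : Matrix α ι ℝ) (B : Matrix ι β ℝ) :
    frob (A * B) ≤ frob A * frob B := by
  simp only [frob_eq_norm]
  exact Matrix.frobenius_norm_mul _ _

lemma frob_transpose (A : Matrix α β ℝ) : frob A.transpose = frob A := by
  unfold frob
  rw [Finset.sum_comm]
  rfl

lemma frob_le_of_abs_le {A B : Matrix α β ℝ} {c : ℝ} (hc : 0 ≤ c)
    (hAB : ∀ i j, |A i j| ≤ c * |B i j|) : frob A ≤ c * frob B := by
  refine le_of_sq_le_sq ?_ (mul_nonneg hc (frob_nonneg B))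
  rw [mul_pow, frob_sq, frob_sq, Finset.mul_sum]
  refine Finset.sum_le_sum fun i _ => ?_
  rw [Finset.mul_sum]
  refine Finset.sum_le_sum fun j _ => ?_
  rw [← sq_abs, ← sq_abs (B i j), ← mul_pow]
  exact pow_le_pow_left₀ (abs_nonneg _) (hAB i j) 2

lemma frob_map_abs (A : Matrix α β ℝ) : frob (A.map fun x => |x|) = frob A := by
  simp [frob]

lemma Stored.frob_sub_le {u : ℝ} (hu : 0 ≤ u) {A B : Matrix α β ℝ} (hAB : Stored u A B) :
    frob (B - A) ≤ u * frob A :=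
  frob_le_of_abs_le hu hAB.abs_sub_le

end Frobenius

/-! ### Low-rank blocks with rounded factors -/

section LowRank

variable {α β : Type} [Fintype α] [Fintype β]

/-- Each column of `M` changes its squared length under `X` by the quadratic form of `XᵀX - 1`,
whose entries are at most `κ * u`. -/
lemma NearlyOrthonormal.abs_frob_mul_sq_sub_le {r : ℕ} {κ u τ : ℝ} {X : Matrix α (Fin r) ℝ}
    (hX : NearlyOrthonormal κ u X) (hκu : 0 ≤ κ * u) (hτ : r * (κ * u) ≤ τ)
    (M : Matrix (Fin r) β ℝ) : |frob (X * M) ^ 2 - frob M ^ 2| ≤ τ * frob M ^ 2 := by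
  have key : ∀ c : Fin r → ℝ,
      |∑ i, (∑ a, X i a * c a) ^ 2 - ∑ a, c a ^ 2| ≤ τ * ∑ a, c a ^ 2 := by
    intro c
    have e : ∑ i, (∑ a, X i a * c a) ^ 2 - ∑ a, c a ^ 2 =
        ∑ a, ∑ b, c a * c b * (X.transpose * X - (1 : Matrix (Fin r) (Fin r) ℝ)) a b := by
      simp only [Matrix.sub_apply, mul_sub, Finset.sum_sub_distrib, Matrix.mul_apply,
        Matrix.transpose_apply, Matrix.one_apply]
      congr 1
      · simp only [sq, Finset.sum_mul_sum]
        simp only [Finset.mul_sum]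
        rw [Finset.sum_comm]
        refine Finset.sum_congr rfl fun a _ => ?_
        rw [Finset.sum_comm]
        exact Finset.sum_congr rfl fun b _ => Finset.sum_congr rfl fun i _ => by ring
      · simp [sq]
    rw [e]
    calc _ ≤ ∑ a, ∑ b, |c a| * |c b| * (κ * u) := by
          refine (Finset.abs_sum_le_sum_abs _ _).trans (Finset.sum_le_sum fun a _ => ?_)
          refine (Finset.abs_sum_le_sum_abs _ _).trans (Finset.sum_le_sum fun b _ => ?_)
          rw [abs_mul, abs_mul]
          exact mul_le_mul_of_nonneg_left (hX a b) (by positivity)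
      _ = (∑ a, |c a|) ^ 2 * (κ * u) := by
          rw [sq, Finset.sum_mul_sum, Finset.sum_mul]
          exact Finset.sum_congr rfl fun a _ => by rw [Finset.sum_mul]
      _ ≤ (r * ∑ a, c a ^ 2) * (κ * u) := by
          refine mul_le_mul_of_nonneg_right ?_ hκu
          simpa using sq_sum_le_card_mul_sum_sq (s := Finset.univ) (f := fun a => |c a|)
      _ = (r * (κ * u)) * ∑ a, c a ^ 2 := by ring
      _ ≤ _ := mul_le_mul_of_nonneg_right hτ (Finset.sum_nonneg fun _ _ => sq_nonneg _)
  rw [frob_sq, frob_sq, Finset.sum_comm, Finset.sum_comm (f := fun i j => M i j ^ 2),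
    ← Finset.sum_sub_distrib, Finset.mul_sum]
  refine (Finset.abs_sum_le_sum_abs _ _).trans (Finset.sum_le_sum fun j _ => ?_)
  simpa [Matrix.mul_apply] using key fun a => M a j

/-- Rounding both factors of an approximate singular value decomposition to precision `v` costs
about `2 * v` relative to the block. Each factor multiplies the rounding error of the other one
almost isometrically, so the bound does not grow with the rank to first order. -/
lemma StoredLowRank.frob_sub_le {p : ℕ} {κ u v : ℝ} {B B' : Matrix α α ℝ}
    (hB : StoredLowRank p κ u v B B') (hκu : 0 ≤ κ * u) (hτ : p * (κ * u) ≤ 1 / 1000)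
    (hv : 0 ≤ v) (hv' : v ≤ 1 / 1000) (hpv : p * v ≤ 1 / 1000) :
    frob (B' - B) ≤ 201 / 100 * v * frob B := by
  obtain ⟨r, X, Y, V, X', V', σ, hr, hX, hY, -, hV, hBX, hX', hV', hB'⟩ := hB
  have hr' : (r : ℝ) ≤ p := by exact_mod_cast hr
  have hτr : r * (κ * u) ≤ 1 / 1000 := (mul_le_mul_of_nonneg_right hr' hκu).trans hτ
  have hrv : r * v ≤ 1 / 1000 := (mul_le_mul_of_nonneg_right hr' hv).trans hpv
  set D := Matrix.diagonal σ with hD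
  have isoV := abs_le.1 (hY.abs_frob_mul_sq_sub_le hκu hτr D)
  have isoXD := abs_le.1 (hX.abs_frob_mul_sq_sub_le hκu hτr D)
  have isoB := abs_le.1 (hX.abs_frob_mul_sq_sub_le hκu hτr V.transpose)
  have iso1 := abs_le.1 (hX.abs_frob_mul_sq_sub_le hκu hτr (1 : Matrix (Fin r) (Fin r) ℝ))
  have isoT1 := abs_le.1 (hY.abs_frob_mul_sq_sub_le hκu hτr ((X' - X) * D).transpose)
  have isoT2 := abs_le.1 (hX.abs_frob_mul_sq_sub_le hκu hτr (V' - V).transpose)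
  have h1 : frob (1 : Matrix (Fin r) (Fin r) ℝ) ^ 2 = r := by
    rw [frob_sq]; simp [Matrix.one_apply]
  rw [← hV] at isoV
  rw [← hBX, frob_transpose] at isoB
  rw [Matrix.mul_one, h1] at iso1
  rw [frob_transpose] at isoT1 isoT2
  have hT1 : Y * ((X' - X) * D).transpose = ((X' - X) * V.transpose).transpose := by
    rw [hV, hD]
    simp [Matrix.transpose_mul, Matrix.mul_assoc]
  rw [hT1, frob_transpose] at isoT1
  have hdXD : frob ((X' - X) * D) ≤ v * frob (X * D) := by
    refine frob_le_of_abs_le hv fun i a => ?_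
    rw [hD, Matrix.mul_diagonal, Matrix.mul_diagonal, abs_mul, abs_mul, ← mul_assoc]
    exact mul_le_mul_of_nonneg_right (hX'.abs_sub_le i a) (abs_nonneg _)
  have hdX := hX'.frob_sub_le hv
  have hdV := hV'.frob_sub_le hv
  have hT3 := frob_mul_le (X' - X) (V' - V).transpose
  rw [frob_transpose] at hT3
  have hsplit : B' - B = (X' - X) * V.transpose + X * (V' - V).transpose
      + (X' - X) * (V' - V).transpose := by
    rw [hB', hBX, Matrix.transpose_sub]
    simp only [Matrix.sub_mul, Matrix.mul_sub]
    abel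
  have hsum : frob (B' - B) ≤ frob ((X' - X) * V.transpose) + frob (X * (V' - V).transpose)
      + frob ((X' - X) * (V' - V).transpose) := by
    rw [hsplit]
    exact (frob_add_le _ _).trans (add_le_add_left (frob_add_le _ _) _)
  have nB := frob_nonneg B
  have nV := frob_nonneg V
  have nXD := frob_nonneg (X * D)
  have hsq : ∀ {x y : ℝ}, 0 ≤ x → x ≤ v * y → x ^ 2 ≤ v ^ 2 * y ^ 2 := fun hx hxy => by
    rw [← mul_pow]; exact pow_le_pow_left₀ hx hxy 2
  have sXD := hsq (frob_nonneg _) hdXD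
  have sV := hsq (frob_nonneg _) hdV
  have v2 : 0 ≤ v ^ 2 := sq_nonneg v
  have bV : frob V ≤ 1001 / 1000 * frob B :=
    le_of_sq_le_sq (by rw [mul_pow]; linarith [sq_nonneg (frob B)]) (by positivity)
  have bXD : frob (X * D) ≤ 1002 / 1000 * frob B :=
    le_of_sq_le_sq (by rw [mul_pow]; linarith [sq_nonneg (frob B)]) (by positivity)
  have bT1 : frob ((X' - X) * V.transpose) ≤ 1003 / 1000 * v * frob B := by
    refine le_of_sq_le_sq ?_ (by positivity)
    have := mul_le_mul_of_nonneg_left (pow_le_pow_left₀ nXD bXD 2) v2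
    have : 0 ≤ v ^ 2 * frob B ^ 2 := by positivity
    rw [mul_pow, mul_pow]; linarith
  have bT2 : frob (X * (V' - V).transpose) ≤ 1003 / 1000 * v * frob B := by
    refine le_of_sq_le_sq ?_ (by positivity)
    have := mul_le_mul_of_nonneg_left (pow_le_pow_left₀ nV bV 2) v2
    have : 0 ≤ v ^ 2 * frob B ^ 2 := by positivity
    rw [mul_pow, mul_pow]; linarith
  have bvX : v * frob X ≤ 1 / 500 := by
    refine le_of_sq_le_sq ?_ (by norm_num)
    have h2 : v ^ 2 * frob X ^ 2 ≤ v ^ 2 * (1001 / 1000 * r) :=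
      mul_le_mul_of_nonneg_left (by linarith) v2
    have h3 : v * (r * v) ≤ 1 / 1000 * (1 / 1000) := mul_le_mul hv' hrv (by positivity) (by norm_num)
    rw [mul_pow]; linarith
  have bT3 : frob ((X' - X) * (V' - V).transpose) ≤ 3 / 1000 * v * frob B := by
    calc _ ≤ 1 / 500 * (v * (1001 / 1000 * frob B)) := by
          refine hT3.trans (mul_le_mul (hdX.trans bvX) (hdV.trans ?_) (frob_nonneg _) (by norm_num))
          exact mul_le_mul_of_nonneg_left bV hv
      _ ≤ _ := by have : 0 ≤ v * frob B := by positivity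
                  linarith
  have : 0 ≤ v * frob B := by positivity
  linarith

end LowRank

/-! ### Block structure -/

section Blocks

variable {m d : ℕ}

lemma frob_sq_blocks (A : Mat m (d + 1)) :
    frob A ^ 2 = frob (b11 A) ^ 2 + frob (b12 A) ^ 2 + frob (b21 A) ^ 2 + frob (b22 A) ^ 2 := by
  simp only [frob_sq]
  have h : ∀ g : Idx m (d + 1) → ℝ, ∑ i, g i = ∑ i, g (Sum.inl i) + ∑ i, g (Sum.inr i) :=
    fun g => Fintype.sum_sum_type g
  simp only [h, Finset.sum_add_distrib, b11, b12, b21, b22]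
  ring

lemma mul_apply_split (A B : Mat m (d + 1)) (i j : Idx m (d + 1)) :
    (A * B) i j = ∑ k, A i (Sum.inl k) * B (Sum.inl k) j + ∑ k, A i (Sum.inr k) * B (Sum.inr k) j :=
  Fintype.sum_sum_type fun k : Idx m d ⊕ Idx m d => A i k * B k j

lemma b11_mul (A B : Mat m (d + 1)) : b11 (A * B) = b11 A * b11 B + b12 A * b21 B := by
  ext i j; exact mul_apply_split A B _ _

lemma b12_mul (A B : Mat m (d + 1)) : b12 (A * B) = b11 A * b12 B + b12 A * b22 B := by
  ext i j; exact mul_apply_split A B _ _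

lemma b21_mul (A B : Mat m (d + 1)) : b21 (A * B) = b21 A * b11 B + b22 A * b21 B := by
  ext i j; exact mul_apply_split A B _ _

lemma b22_mul (A B : Mat m (d + 1)) : b22 (A * B) = b21 A * b12 B + b22 A * b22 B := by
  ext i j; exact mul_apply_split A B _ _

lemma b11_sub (A B : Mat m (d + 1)) : b11 (A - B) = b11 A - b11 B := rfl
lemma b12_sub (A B : Mat m (d + 1)) : b12 (A - B) = b12 A - b12 B := rfl
lemma b21_sub (A B : Mat m (d + 1)) : b21 (A - B) = b21 A - b21 B := rfl
lemma b22_sub (A B : Mat m (d + 1)) : b22 (A - B) = b22 A - b22 B := rfl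

end Blocks

/-! ### Error of the representation -/

section Representation

variable {m : ℕ}

lemma IsHODLRApprox.frob_sub_le {ε : ℝ} (hε : 0 ≤ ε) :
    ∀ {d : ℕ} {H H' : Mat m d}, IsHODLRApprox ε d H H' → frob (H' - H) ≤ ε * frob H
  | 0, H, H', h => by
    have h : H' = H := h
    rw [h, sub_self]
    have : frob (0 : Mat m 0) = 0 := by simp [frob]
    rw [this]
    exact mul_nonneg hε (frob_nonneg H)
  | d + 1, H, H', h => by
    obtain ⟨h12, h21, h11, h22⟩ := h
    have h11 := h11.frob_sub_le hε
    have h22 := h22.frob_sub_le hε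
    refine le_of_sq_le_sq ?_ (mul_nonneg hε (frob_nonneg H))
    rw [mul_pow, frob_sq_blocks, frob_sq_blocks H, b11_sub, b12_sub, b21_sub, b22_sub]
    have h11 := pow_le_pow_left₀ (frob_nonneg _) h11 2
    have h12 := pow_le_pow_left₀ (frob_nonneg _) h12 2
    have h21 := pow_le_pow_left₀ (frob_nonneg _) h21 2
    have h22 := pow_le_pow_left₀ (frob_nonneg _) h22 2
    rw [mul_pow] at h11 h12 h21 h22
    linarith

lemma offMax_nonneg : ∀ {d : ℕ} (H : Mat m d) (k : ℕ), 0 ≤ offMax d H k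
  | 0, _, _ => le_rfl
  | _ + 1, _, 0 => le_rfl
  | _ + 1, _, 1 => le_max_of_le_left (frob_nonneg _)
  | _ + 1, _, k + 2 => le_max_of_le_left (offMax_nonneg _ (k + 1))

/-- There are `2 ^ j` sibling blocks of relative level `j`, so if each level satisfies the adaptive
choice of its precision with bound `Q`, each of the `d` levels contributes a multiple of `Q` to the
squared error. -/
lemma MixedRep.frob_sub_sq_le {p : ℕ} {κ u ε : ℝ} {w : ℕ → ℝ} (hκu : 0 ≤ κ * u)
    (hτ : p * (κ * u) ≤ 1 / 1000) (hu : 0 ≤ u) (hε' : ε ≤ 1 / 1000) :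
    ∀ {d k : ℕ} {H H' B : Mat m d} {Q : ℝ}, IsHODLRApprox ε d H H' → MixedRep p κ u w d k H' B →
      (∀ j, 1 ≤ j → j ≤ d → 0 ≤ w (k + j) ∧ w (k + j) ≤ 1 / 1000 ∧ p * w (k + j) ≤ 1 / 1000) →
      (∀ j, 1 ≤ j → j ≤ d → 2 ^ j * (offMax d H j * w (k + j)) ^ 2 ≤ Q) →
      frob (B - H') ^ 2 ≤ 5 * d * Q + u ^ 2 * frob H' ^ 2
  | 0, k, H, H', B, Q, _, hB, _, _ => by
    have hB : Stored u H' B := hB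
    have := pow_le_pow_left₀ (frob_nonneg _) (hB.frob_sub_le hu) 2
    rw [mul_pow] at this
    simpa using this
  | d + 1, k, H, H', B, Q, hH, hB, hw, hQ => by
    obtain ⟨h12, h21, h11, h22⟩ := hH
    obtain ⟨g12, g21, g11, g22⟩ := hB
    have hw' : ∀ j, 1 ≤ j → j ≤ d →
        0 ≤ w (k + 1 + j) ∧ w (k + 1 + j) ≤ 1 / 1000 ∧ p * w (k + 1 + j) ≤ 1 / 1000 := by
      intro j _ hj
      rw [show k + 1 + j = k + (j + 1) by ring]
      exact hw (j + 1) (by omega) (by omega)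
    have hsub : ∀ j, 1 ≤ j → j ≤ d → ∀ x, 0 ≤ x → x ≤ offMax (d + 1) H (j + 1) →
        2 ^ j * (x * w (k + 1 + j)) ^ 2 ≤ Q / 2 := by
      intro j _ hj x hx hx'
      have h := hQ (j + 1) (by omega) (by omega)
      rw [show k + (j + 1) = k + 1 + j by ring] at h
      have : (x * w (k + 1 + j)) ^ 2 ≤ (offMax (d + 1) H (j + 1) * w (k + 1 + j)) ^ 2 :=
        pow_le_pow_left₀ (mul_nonneg hx (hw' j ‹_› hj).1)
          (mul_le_mul_of_nonneg_right hx' (hw' j ‹_› hj).1) 2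
      have := mul_le_mul_of_nonneg_left this (show (0 : ℝ) ≤ 2 ^ j by positivity)
      rw [pow_succ] at h
      linarith
    have r11 := g11.frob_sub_sq_le hκu hτ hu hε' h11 hw' fun j hj hjd => by
      obtain ⟨i, rfl⟩ : ∃ i, j = i + 1 := ⟨j - 1, by omega⟩
      exact hsub _ hj hjd _ (offMax_nonneg _ _) (le_max_left _ _)
    have r22 := g22.frob_sub_sq_le hκu hτ hu hε' h22 hw' fun j hj hjd => by
      obtain ⟨i, rfl⟩ : ∃ i, j = i + 1 := ⟨j - 1, by omega⟩
      exact hsub _ hj hjd _ (offMax_nonneg _ _) (le_max_right _ _)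
    obtain ⟨w0, w1, w2⟩ := hw 1 le_rfl (by omega)
    have q1 := hQ 1 le_rfl (by omega)
    have off : ∀ {X X' Z : Mat m d}, frob (X' - X) ≤ ε * frob X →
        StoredLowRank p κ u (w (k + 1)) X' Z → frob X ≤ offMax (d + 1) H 1 →
        frob (Z - X') ^ 2 ≤ 5 / 2 * Q := by
      intro X X' Z hX hZ hle
      have h1 := hZ.frob_sub_le hκu hτ w0 w1 w2
      have h2 := frob_le_add_sub X' X
      have h3 : frob X' ≤ 1001 / 1000 * offMax (d + 1) H 1 := by
        have := mul_le_mul_of_nonneg_right hε' (frob_nonneg X)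
        linarith
      have h4 : frob (Z - X') ≤ 202 / 100 * (offMax (d + 1) H 1 * w (k + 1)) := by
        have := mul_le_mul_of_nonneg_left h3 w0
        have := mul_nonneg (offMax_nonneg H 1) w0
        nlinarith
      have h5 := pow_le_pow_left₀ (frob_nonneg _) h4 2
      rw [mul_pow] at h5
      have := sq_nonneg (offMax (d + 1) H 1 * w (k + 1))
      linarith
    have r12 := off h12 g12 (le_max_left _ _)
    have r21 := off h21 g21 (le_max_right _ _)
    rw [frob_sq_blocks, frob_sq_blocks H', b11_sub, b12_sub, b21_sub, b22_sub]
    push_cast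
    have e12 : 0 ≤ u ^ 2 * frob (b12 H') ^ 2 := by positivity
    have e21 : 0 ≤ u ^ 2 * frob (b21 H') ^ 2 := by positivity
    linarith

/-- The error of the adaptive-precision construction, relative to `‖H‖`. -/
lemma AdaptiveHODLR.frob_sub_le {p : ℕ} {κ u ε : ℝ} {P : Finset ℝ} {ℓ : ℕ} {H B : Mat m ℓ}
    {w : ℕ → ℝ} (hB : AdaptiveHODLR p κ u ε P ℓ H w B) (hℓ : 1 ≤ ℓ) (hκu : 0 ≤ κ * u)
    (hτ : p * (κ * u) ≤ 1 / 1000) (hu : 0 ≤ u) (hP : ∀ v ∈ P, 0 ≤ v) (huε : u ≤ 3 / 5 * ε)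
    (hε' : ε ≤ 1 / 1000)
    (hw : ∀ k, 1 ≤ k → k ≤ ℓ → w k ≤ 1 / 1000 ∧ p * w k ≤ 1 / 1000) :
    frob (B - H) ≤ 4 * ℓ * ε * frob H := by
  obtain ⟨hgr, H', hH', hrep⟩ := hB
  have hε : 0 ≤ ε := by linarith
  have hw0 : ∀ k, 1 ≤ k → k ≤ ℓ → 0 ≤ w k := fun k h1 h2 => by
    rcases Finset.mem_insert.1 (hgr k h1 h2).1.1 with h | h
    · rw [h]; exact hu
    · exact hP _ h
  have hl : (1 : ℝ) ≤ ℓ := by exact_mod_cast hℓ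
  have nH := frob_nonneg H
  have happ := hH'.frob_sub_le hε
  have hmix := hrep.frob_sub_sq_le (Q := (ε * frob H) ^ 2) hκu hτ hu hε' hH'
    (fun j h1 h2 => by rw [zero_add]; exact ⟨hw0 j h1 h2, hw j h1 h2⟩)
    (fun j h1 h2 => by
      rw [zero_add]
      have h := (hgr j h1 h2).1.2
      have h := pow_le_pow_left₀
        (mul_nonneg (mul_nonneg (by positivity) (offMax_nonneg H j)) (hw0 j h1 h2)) h 2
      have e : (√2 ^ j * offMax ℓ H j * w j) ^ 2 = 2 ^ j * (offMax ℓ H j * w j) ^ 2 := by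
        rw [mul_assoc, mul_pow, ← pow_mul, mul_comm j 2, pow_mul, Real.sq_sqrt (by norm_num)]
      rwa [e] at h)
  have hH'n : frob H' ≤ 1001 / 1000 * frob H := by
    have := frob_le_add_sub H' H
    have := mul_le_mul_of_nonneg_right hε' nH
    linarith
  have hlow : u * frob H' ≤ 7 / 10 * (ε * frob H) := by
    have := mul_le_mul huε hH'n (frob_nonneg _) (by positivity)
    have : 0 ≤ ε * frob H := by positivity
    nlinarith
  have hlow2 := pow_le_pow_left₀ (mul_nonneg hu (frob_nonneg _)) hlow 2
  rw [mul_pow, mul_pow _ (ε * frob H)] at hlow2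
  have hmix2 : frob (B - H') ≤ 3 * ℓ * (ε * frob H) := by
    refine le_of_sq_le_sq ?_ (by positivity)
    rw [mul_pow]
    have h1 : (5 * ℓ + 1 : ℝ) ≤ (3 * ℓ) ^ 2 := by nlinarith
    have h2 := mul_le_mul_of_nonneg_right h1 (sq_nonneg (ε * frob H))
    linarith [sq_nonneg (ε * frob H)]
  have hadd : frob (B - H) ≤ frob (B - H') + frob (H' - H) := by
    simpa using frob_add_le (B - H') (H' - H)
  have : 1 * (ε * frob H) ≤ ℓ * (ε * frob H) := mul_le_mul_of_nonneg_right hl (by positivity)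
  linarith

end Representation

/-! ### Dense LU factorization -/

section DenseLU

lemma FlSum.abs_sub_sum_le {u : ℝ} (hu : 0 ≤ u) {s : Multiset ℝ} {x : ℝ} (h : FlSum u s x) :
    1 ≤ s.card ∧ |x - s.sum| ≤ ((1 + u) ^ s.card - 1) * (s.map fun y => |y|).sum := by
  induction h with
  | single x => simpa using mul_nonneg hu (abs_nonneg x)
  | @add s t x y z _ _ hz ihs iht =>
    obtain ⟨cs, hs⟩ := ihs
    obtain ⟨ct, ht⟩ := iht
    obtain ⟨η, hη, rfl⟩ := hz
    simp only [Multiset.card_add, Multiset.sum_add, Multiset.map_add]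
    refine ⟨by omega, ?_⟩
    have habs : ∀ s : Multiset ℝ, |s.sum| ≤ (s.map fun y => |y|).sum :=
      fun _ => Multiset.abs_sum_le_sum_abs
    have hs' := habs s
    have ht' := habs t
    set A := (s.map fun y => |y|).sum
    set B := (t.map fun y => |y|).sum
    have hA : 0 ≤ A := (abs_nonneg _).trans hs'
    have hB : 0 ≤ B := (abs_nonneg _).trans ht'
    have hone : 1 ≤ 1 + u := by linarith
    have p1 : (1 + u) * (1 + u) ^ s.card ≤ (1 + u) ^ (s.card + t.card) := by
      rw [← pow_succ']; exact pow_le_pow_right₀ hone (by omega)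
    have p2 : (1 + u) * (1 + u) ^ t.card ≤ (1 + u) ^ (s.card + t.card) := by
      rw [← pow_succ']; exact pow_le_pow_right₀ hone (by omega)
    have e : (x + y) * (1 + η) - (s.sum + t.sum) =
        (x - s.sum) + (y - t.sum) + η * ((x - s.sum) + (y - t.sum) + s.sum + t.sum) := by ring
    have h1 : |(x - s.sum) + (y - t.sum) + s.sum + t.sum| ≤
        |x - s.sum| + |y - t.sum| + |s.sum| + |t.sum| := by
      refine (abs_add_le _ _).trans (add_le_add_left ?_ _)
      exact (abs_add_le _ _).trans (add_le_add_left (abs_add_le _ _) _)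
    have h2 : |η * ((x - s.sum) + (y - t.sum) + s.sum + t.sum)| ≤
        u * (|x - s.sum| + |y - t.sum| + A + B) := by
      rw [abs_mul]
      exact mul_le_mul hη (by linarith) (abs_nonneg _) hu
    have h3 : |(x + y) * (1 + η) - (s.sum + t.sum)| ≤
        (1 + u) * (|x - s.sum| + |y - t.sum|) + u * (A + B) := by
      rw [e]
      have := abs_add_le ((x - s.sum) + (y - t.sum))
        (η * ((x - s.sum) + (y - t.sum) + s.sum + t.sum))
      have := abs_add_le (x - s.sum) (y - t.sum)
      linarith
    have h4 := mul_le_mul_of_nonneg_left (add_le_add hs ht) (show 0 ≤ 1 + u by linarith)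
    have h5 := mul_le_mul_of_nonneg_right p1 hA
    have h6 := mul_le_mul_of_nonneg_right p2 hB
    linarith

lemma one_add_pow_sub_one_le {u : ℝ} (hu : 0 ≤ u) {k m : ℕ} (hk : k ≤ m) (hmu : m * u ≤ 1 / 2) :
    (1 + u) ^ k - 1 ≤ 2 * (m * u) := by
  have h1 : (1 + u) ^ k ≤ (1 + u) ^ m := pow_le_pow_right₀ (by linarith) hk
  have h2 : (1 + u) ^ m ≤ Real.exp (m * u) := by
    rw [Real.exp_nat_mul]
    exact pow_le_pow_left₀ (by linarith) (by linarith [Real.add_one_le_exp u]) m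
  have hx : 0 ≤ m * u := by positivity
  have h3 : Real.exp (m * u) * (1 - m * u) ≤ 1 := by
    have := mul_le_mul_of_nonneg_left (Real.one_sub_le_exp_neg (m * u)) (Real.exp_pos (m * u)).le
    rwa [← Real.exp_add, add_neg_cancel, Real.exp_zero] at this
  nlinarith [Real.exp_pos (m * u)]

variable {m : ℕ}

/-- The initial value `a` does not occur in the bound, since it is itself bounded by the result, the
subtracted products and the error. -/
lemma FlResidual.abs_sub_le {u a x : ℝ} {L U : Matrix (Fin m) (Fin m) ℝ} {i j r : Fin m}
    (h : FlResidual u a L U i j r x) (hu : 0 ≤ u) (hmu : m * u ≤ 1 / 200) :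
    |x + ∑ t with t < r, L i t * U t j - a| ≤
      6 * (m * u) * (|x| + ∑ t with t < r, |L i t| * |U t j|) := by
  obtain ⟨q, hq, hx⟩ := h
  obtain ⟨-, hx⟩ := hx.abs_sub_sum_le hu
  set F := Finset.univ.filter fun t : Fin m => t < r with hF
  set W := ∑ t ∈ F, |L i t| * |U t j| with hW
  have hW0 : 0 ≤ W := Finset.sum_nonneg fun _ _ => by positivity
  have hm : 1 ≤ m := by have := r.2; omega
  have hm' : (1 : ℝ) ≤ m := by exact_mod_cast hm
  have humu : u ≤ m * u := by nlinarith
  have hcard : F.card + 1 ≤ m := by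
    have : F = Finset.Iio r := by ext; simp [hF]
    rw [this, Fin.card_Iio]
    exact r.2
  have hqd : ∀ t ∈ F, |q t - L i t * U t j| ≤ u * (|L i t| * |U t j|) := by
    intro t ht
    obtain ⟨η, hη, e⟩ := hq t (Finset.mem_filter.1 ht).2
    rw [e, show L i t * U t j * (1 + η) - L i t * U t j = η * (L i t * U t j) by ring, abs_mul,
      abs_mul]
    exact mul_le_mul_of_nonneg_right hη (by positivity)
  have hq1 : |∑ t ∈ F, q t - ∑ t ∈ F, L i t * U t j| ≤ u * W := by
    rw [← Finset.sum_sub_distrib, hW, Finset.mul_sum]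
    exact (Finset.abs_sum_le_sum_abs _ _).trans (Finset.sum_le_sum hqd)
  have hq2 : ∑ t ∈ F, |q t| ≤ (1 + u) * W := by
    rw [hW, Finset.mul_sum]
    refine Finset.sum_le_sum fun t ht => ?_
    have h1 := abs_sub_abs_le_abs_sub (q t) (L i t * U t j)
    have h2 := hqd t ht
    rw [abs_mul] at h1
    linarith
  have hLU : |∑ t ∈ F, L i t * U t j| ≤ W :=
    (Finset.abs_sum_le_sum_abs _ _).trans (Finset.sum_le_sum fun t _ => (abs_mul _ _).le)
  have e1 : (a ::ₘ F.val.map fun t => -q t).sum = a - ∑ t ∈ F, q t := by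
    rw [Multiset.sum_cons, sub_eq_add_neg, ← Finset.sum_neg_distrib]
    rfl
  have e2 : ((a ::ₘ F.val.map fun t => -q t).map fun y => |y|).sum = |a| + ∑ t ∈ F, |q t| := by
    rw [Multiset.map_cons, Multiset.sum_cons, Multiset.map_map]
    congr 1
    exact Finset.sum_congr rfl fun t _ => abs_neg _
  have e3 : (a ::ₘ F.val.map fun t => -q t).card = F.card + 1 := by simp
  rw [e1, e2, e3] at hx
  have hg := one_add_pow_sub_one_le hu hcard (by linarith)
  have hx2 : |x - (a - ∑ t ∈ F, q t)| ≤ 2 * (m * u) * (|a| + (1 + u) * W) := by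
    refine hx.trans (mul_le_mul hg (by linarith) ?_ (by positivity))
    exact add_nonneg (abs_nonneg _) (Finset.sum_nonneg fun _ _ => abs_nonneg _)
  set S := ∑ t ∈ F, L i t * U t j
  have herr : |x + S - a| ≤ 2 * (m * u) * (|a| + (1 + u) * W) + u * W := by
    rw [show x + S - a = (x - (a - ∑ t ∈ F, q t)) - (∑ t ∈ F, q t - S) by ring]
    exact (abs_sub _ _).trans (add_le_add hx2 hq1)
  have ha : |a| ≤ |x| + W + |x + S - a| := by
    rw [show a = x + S - (x + S - a) by ring]
    have h1 := abs_sub (x + S) (x + S - a)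
    have h2 := abs_add_le x S
    simp only [sub_sub_cancel] at *
    linarith
  have hx0 := abs_nonneg x
  have he0 := abs_nonneg (x + S - a)
  set μ := (m : ℝ) * u
  have hμ : 0 ≤ μ := by positivity
  have k1 : 2 * μ * (|a| + (1 + u) * W) ≤
      2 * μ * (|x| + |x + S - a| + (2 + 1 / 200) * W) :=
    mul_le_mul_of_nonneg_left (by nlinarith) (by positivity)
  have k2 : u * W ≤ μ * W := mul_le_mul_of_nonneg_right humu hW0
  have k3 : μ * |x + S - a| ≤ 1 / 200 * |x + S - a| := mul_le_mul_of_nonneg_right hmu he0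
  have k4 : 0 ≤ μ * W := by positivity
  have k5 : 0 ≤ μ * |x| := by positivity
  linarith

lemma sum_eq_sum_lt_add {g : Fin m → ℝ} {r : Fin m} (hg : ∀ t, r < t → g t = 0) :
    ∑ t, g t = ∑ t with t < r, g t + g r := by
  rw [← Finset.sum_filter_add_sum_filter_not Finset.univ (fun t => t < r)]
  congr 1
  refine Finset.sum_eq_single_of_mem r (by simp) fun t ht htr => hg t ?_
  exact lt_of_le_of_ne (not_lt.1 (Finset.mem_filter.1 ht).2) (Ne.symm htr)

/-- Componentwise backward error of Gaussian elimination. -/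
lemma DenseLU.abs_sub_le {u : ℝ} {A L U : Matrix (Fin m) (Fin m) ℝ} (h : DenseLU u A L U)
    (hu : 0 ≤ u) (hmu : m * u ≤ 1 / 200) (i j : Fin m) :
    |(L * U - A) i j| ≤ 8 * (m * u) * ∑ t, |L i t| * |U t j| := by
  obtain ⟨hL1, hL0, hU0, hU, hL⟩ := h
  have hm : 1 ≤ m := by have := i.2; omega
  have hm' : (1 : ℝ) ≤ m := by exact_mod_cast hm
  have humu : u ≤ m * u := by nlinarith
  have hμ : 0 ≤ m * u := by positivity
  have hW : ∀ r : Fin m, 0 ≤ ∑ t with t < r, |L i t| * |U t j| :=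
    fun r => Finset.sum_nonneg fun _ _ => by positivity
  rw [Matrix.sub_apply, Matrix.mul_apply]
  rcases le_or_gt i j with hij | hij
  · have hz : ∀ t, i < t → L i t = 0 := fun t ht => hL0 i t ht
    rw [sum_eq_sum_lt_add (r := i) fun t ht => by rw [hz t ht, zero_mul],
      sum_eq_sum_lt_add (r := i) fun t ht => by rw [hz t ht, abs_zero, zero_mul], hL1, abs_one,
      one_mul, one_mul, add_comm, add_comm (∑ t with t < i, |L i t| * |U t j|)]
    refine ((hU i j hij).abs_sub_le hu hmu).trans ?_
    exact mul_le_mul_of_nonneg_right (by linarith) (add_nonneg (abs_nonneg _) (hW i))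
  · have hz : ∀ t, j < t → U t j = 0 := fun t ht => hU0 t j ht
    rw [sum_eq_sum_lt_add (r := j) fun t ht => by rw [hz t ht, mul_zero],
      sum_eq_sum_lt_add (r := j) fun t ht => by rw [hz t ht, abs_zero, mul_zero]]
    obtain ⟨hne, s, hs, η, hη, hLij⟩ := hL i j hij
    have hs := hs.abs_sub_le hu hmu
    have hW := hW j
    set S := ∑ t with t < j, L i t * U t j
    set W := ∑ t with t < j, |L i t| * |U t j|
    have hprod : L i j * U j j = s * (1 + η) := by
      rw [hLij]; field_simp
    rw [← abs_mul, hprod]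
    have h1 : |s * (1 + η) - s| ≤ m * u * |s| := by
      rw [show s * (1 + η) - s = η * s by ring, abs_mul]
      exact mul_le_mul_of_nonneg_right (hη.trans humu) (abs_nonneg _)
    have h2 : |s| ≤ |s * (1 + η)| + |s * (1 + η) - s| := by
      have := abs_sub_abs_le_abs_sub s (s * (1 + η))
      rw [abs_sub_comm] at this
      linarith
    have h3 : |S + s * (1 + η) - A i j| ≤ |s + S - A i j| + |s * (1 + η) - s| := by
      rw [show S + s * (1 + η) - A i j = (s + S - A i j) + (s * (1 + η) - s) by ring]
      exact abs_add_le _ _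
    have hs0 := abs_nonneg s
    have h4 : |s| ≤ 8 / 7 * |s * (1 + η)| := by nlinarith
    have h5 := mul_le_mul_of_nonneg_left h4 hμ
    have h6 : 0 ≤ m * u * W := by positivity
    linarith

lemma DenseLU.frob_sub_le {u : ℝ} {A L U : Matrix (Fin m) (Fin m) ℝ} (h : DenseLU u A L U)
    (hu : 0 ≤ u) (hmu : m * u ≤ 1 / 200) :
    frob (L * U - A) ≤ 8 * (m * u) * (frob L * frob U) := by
  have hμ : 0 ≤ 8 * (m * u) := by positivity
  refine (frob_le_of_abs_le (B := L.map (fun x => |x|) * U.map fun x => |x|) hμ fun i j => ?_).trans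
    (mul_le_mul_of_nonneg_left ?_ hμ)
  · refine (h.abs_sub_le hu hmu i j).trans (mul_le_mul_of_nonneg_left ?_ hμ)
    exact le_abs_self _
  · simpa only [frob_map_abs] using frob_mul_le (L.map fun x => |x|) (U.map fun x => |x|)

end DenseLU

/-! ### Recursive LU factorization -/

section RecursiveLU

variable {m : ℕ}

/-- Every block error is at most `c` times a product of norms of blocks of the factors, and these
products combine to `‖L‖ * ‖U‖` by Cauchy–Schwarz. -/
lemma frob_le_of_blocks {d : ℕ} {c : ℝ} (hc : 0 ≤ c) {E L U : Mat m (d + 1)}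
    (h11 : frob (b11 E) ≤ c * (frob (b11 L) * frob (b11 U)))
    (h12 : frob (b12 E) ≤ c * (frob (b11 L) * frob (b12 U)))
    (h21 : frob (b21 E) ≤ c * (frob (b21 L) * frob (b11 U)))
    (h22 : frob (b22 E) ≤ c * (frob (b21 L) * frob (b12 U) + frob (b22 L) * frob (b22 U))) :
    frob E ≤ c * (frob L * frob U) := by
  refine le_of_sq_le_sq ?_ (mul_nonneg hc (mul_nonneg (frob_nonneg _) (frob_nonneg _)))
  have g11 := pow_le_pow_left₀ (frob_nonneg _) h11 2
  have g12 := pow_le_pow_left₀ (frob_nonneg _) h12 2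
  have g21 := pow_le_pow_left₀ (frob_nonneg _) h21 2
  have g22 := pow_le_pow_left₀ (frob_nonneg _) h22 2
  rw [mul_pow, mul_pow, frob_sq_blocks E, frob_sq_blocks L, frob_sq_blocks U]
  rw [mul_pow] at g11 g12 g21 g22
  refine (add_le_add (add_le_add (add_le_add g11 g12) g21) g22).trans ?_
  rw [← mul_add, ← mul_add, ← mul_add]
  refine mul_le_mul_of_nonneg_left ?_ (sq_nonneg c)
  generalize frob (b11 L) = x1
  generalize frob (b12 L) = x2
  generalize frob (b21 L) = x3
  generalize frob (b22 L) = x4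
  generalize frob (b11 U) = y1
  generalize frob (b12 U) = y2
  generalize frob (b21 U) = y3
  generalize frob (b22 U) = y4
  have r : (x1 ^ 2 + x2 ^ 2 + x3 ^ 2 + x4 ^ 2) * (y1 ^ 2 + y2 ^ 2 + y3 ^ 2 + y4 ^ 2) -
      ((x1 * y1) ^ 2 + (x1 * y2) ^ 2 + (x3 * y1) ^ 2 + (x3 * y2 + x4 * y4) ^ 2) =
      (x3 * y4 - x4 * y2) ^ 2 + x1 ^ 2 * (y3 ^ 2 + y4 ^ 2) + x3 ^ 2 * y3 ^ 2 +
        x4 ^ 2 * (y1 ^ 2 + y3 ^ 2) + x2 ^ 2 * (y1 ^ 2 + y2 ^ 2 + y3 ^ 2 + y4 ^ 2) := by ring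
  have : 0 ≤ (x3 * y4 - x4 * y2) ^ 2 + x1 ^ 2 * (y3 ^ 2 + y4 ^ 2) + x3 ^ 2 * y3 ^ 2 +
        x4 ^ 2 * (y1 ^ 2 + y3 ^ 2) + x2 ^ 2 * (y1 ^ 2 + y2 ^ 2 + y3 ^ 2 + y4 ^ 2) := by positivity
  linarith

/-- Backward error of the recursive factorization, relative to `‖L‖ * ‖U‖` alone. -/
lemma HODLRLU.frob_sub_le {f h : ℕ → ℝ} {p : ℕ} {u ε : ℝ} (hu : 0 ≤ u) (huε : u ≤ 3 / 5 * ε)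
    (hmu : m * u ≤ 3 / 5 * ε) :
    ∀ {d : ℕ} {A L U : Mat m d}, (5 + 2 * d) * ε ≤ 1 / 100 →
      (∀ k < d, f (2 ^ k * m) * u ≤ ε ∧ h (2 ^ k * m) * u ≤ ε) →
      HODLRLU f h p u ε d A L U → frob (L * U - A) ≤ (5 + 2 * d) * ε * (frob L * frob U)
  | 0, A, L, U, hsmall, _, hLU => by
    have hε : 0 ≤ ε := by linarith
    push_cast at hsmall ⊢
    have hLU : DenseLU (m := m) u A L U := hLU
    refine (hLU.frob_sub_le hu (by linarith)).trans (mul_le_mul_of_nonneg_right (by linarith) ?_)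
    exact mul_nonneg (frob_nonneg _) (frob_nonneg _)
  | d + 1, A, L, U, hsmall, hfh, hLU => by
    obtain ⟨hL12, hU21, r11, ⟨E12, s12, e12⟩, ⟨E21, s21, e21⟩, Z, S, S', ⟨EZ, sZ, eZ⟩, hS,
      ⟨-, hS'⟩, r22⟩ := hLU
    have hε : 0 ≤ ε := by linarith
    push_cast at hsmall ⊢
    have hsm : (5 + 2 * (d : ℝ)) * ε ≤ 1 / 100 := by linarith
    have hε' : ε ≤ 1 / 100 := by nlinarith [show (0 : ℝ) ≤ d * ε by positivity]
    have r11 := r11.frob_sub_le hu huε hmu hsm fun k hk => hfh k (by omega)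
    have r22 := r22.frob_sub_le hu huε hmu hsm fun k hk => hfh k (by omega)
    obtain ⟨hf, hh⟩ := hfh d (by omega)
    have hεc : ε ≤ (5 + 2 * ((d : ℝ) + 1)) * ε := by
      nlinarith [show (0 : ℝ) ≤ d * ε by positivity]
    have kern : ∀ {c x y e : ℝ}, c * u ≤ ε → 0 ≤ x → 0 ≤ y → e ≤ c * u * x * y →
        e ≤ (5 + 2 * ((d : ℝ) + 1)) * ε * (x * y) := fun hc hx hy he => by
      rw [mul_assoc] at he
      exact he.trans (mul_le_mul_of_nonneg_right (hc.trans hεc) (mul_nonneg hx hy))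
    have n := fun X : Mat m d => frob_nonneg X
    refine frob_le_of_blocks (hε.trans hεc) ?_ ?_ ?_ ?_
    · rw [b11_sub, b11_mul, hL12, Matrix.zero_mul, add_zero]
      exact r11.trans (mul_le_mul_of_nonneg_right (by linarith) (mul_nonneg (n _) (n _)))
    · rw [b12_sub, b12_mul, hL12, Matrix.zero_mul, add_zero, s12, add_sub_cancel_left]
      exact kern hf (n _) (n _) e12
    · rw [b21_sub, b21_mul, hU21, Matrix.mul_zero, add_zero, s21, add_sub_cancel_left]
      rw [mul_comm (frob (b21 L))]
      exact kern hf (n _) (n _) e21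
    · have hst := hS.frob_sub_le hu
      have eZ := kern hh (n _) (n _) eZ
      set Λ := frob (b22 L) * frob (b22 U) with hΛ
      have hΛ0 : 0 ≤ Λ := mul_nonneg (n _) (n _)
      -- the Schur complement is bounded by the factors computed from it
      have hS'n : frob S' ≤ 101 / 100 * Λ := by
        have h1 := frob_le_add_sub S' (b22 L * b22 U)
        rw [frob_sub_comm] at h1
        have h2 := frob_mul_le (b22 L) (b22 U)
        have h3 := mul_le_mul_of_nonneg_right hsm hΛ0
        linarith
      have hSn : frob S ≤ 103 / 100 * Λ := by
        have h1 := frob_le_add_sub S S'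
        rw [frob_sub_comm] at h1
        have h2 := mul_le_mul_of_nonneg_right hε' (n S)
        linarith
      have hCn : frob (b22 A - Z) ≤ 105 / 100 * Λ := by
        have h1 := frob_le_add_sub (b22 A - Z) S
        rw [frob_sub_comm _ S] at h1
        have h2 := mul_le_mul_of_nonneg_right (show u ≤ 1 / 100 by linarith) (n (b22 A - Z))
        linarith
      have hsplit : b21 L * b12 U + b22 L * b22 U - b22 A =
          (b22 L * b22 U - S') + (S' - S) + (S - (b22 A - Z)) + -EZ := by
        rw [sZ]; abel
      rw [b22_sub, b22_mul, hsplit]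
      have t1 := frob_add_le ((b22 L * b22 U - S') + (S' - S) + (S - (b22 A - Z))) (-EZ)
      have t2 := frob_add_le ((b22 L * b22 U - S') + (S' - S)) (S - (b22 A - Z))
      have t3 := frob_add_le (b22 L * b22 U - S') (S' - S)
      rw [frob_neg] at t1
      have k1 := mul_le_mul_of_nonneg_left hSn hε
      have k2 := mul_le_mul huε hCn (n _) (by positivity)
      have k3 : 0 ≤ ε * Λ := by positivity
      linarith

end RecursiveLU

end HODLR

/-! ### Combination of the two errors -/

open HODLR in
theorem corollary3p8 (ℓ m p : ℕ) (hℓ : 1 ≤ ℓ) (hm : 1 ≤ m) (K κ : ℝ) (hK : 0 ≤ K) (hκ : 0 ≤ κ) :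
    ∃ C δ₀ : ℝ, 0 ≤ C ∧ 0 < δ₀ ∧
      ∀ (u ε δ : ℝ) (P : Finset ℝ) (w f h : ℕ → ℝ) (H Hhat Lhat Uhat : HODLR.Mat m ℓ),
        0 < u → 0 < ε → (∀ v ∈ P, 0 < v) →
        -- all the small quantities are at most `δ`, which is small
        ε ≤ δ → (∀ k, 1 ≤ k → k ≤ ℓ → w k ≤ δ) → δ ≤ δ₀ →
        HODLR.IsHODLR p ℓ H →
        HODLR.AdaptiveHODLR p κ u ε P ℓ H w Hhat →
        -- `u ≲ ε / n`, where `n = 2 ^ ℓ * m`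
        HODLR.LeFirstOrder K δ u (ε / ((2 ^ ℓ * m : ℕ) : ℝ)) →
        (∀ k, 1 ≤ k → k ≤ 2 ^ ℓ * m → f k * u ≤ HODLR.gam u k ∧ h k * u ≤ HODLR.gam u k) →
        HODLR.HODLRLU f h p u ε ℓ Hhat Lhat Uhat →
        ∃ ΔH : HODLR.Mat m ℓ, Lhat * Uhat = H + ΔH ∧
          HODLR.LeFirstOrder C δ (HODLR.frob ΔH)
            (2 * (2 ^ ℓ - 1) * ε * HODLR.frob H +
              11 * (2 ^ ℓ - 1) * ε * HODLR.frob Lhat * HODLR.frob Uhat) := by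
  set D : ℝ := 1000 * (2 ^ ℓ + K + p * κ + p) with hD
  have h2ℓ : (ℓ : ℝ) + 1 ≤ 2 ^ ℓ := by exact_mod_cast Nat.lt_two_pow_self
  have hl : (1 : ℝ) ≤ ℓ := by exact_mod_cast hℓ
  have hm' : (1 : ℝ) ≤ m := by exact_mod_cast hm
  have hpκ : 0 ≤ p * κ := by positivity
  have hp : (0 : ℝ) ≤ p := by positivity
  have hD0 : 0 < D := by rw [hD]; linarith
  refine ⟨0, 1 / D, le_rfl, by positivity, ?_⟩
  intro u ε δ P w f h H Hhat Lhat Uhat hu hε hP hεδ hw hδ _ hHhat hfirst hfh hLU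
  have hδ0 : 0 < δ := hε.trans_le hεδ
  have hδD : δ * D ≤ 1 := by rwa [le_div_iff₀ hD0] at hδ
  have hδ2 : 0 ≤ δ * 2 ^ ℓ := by positivity
  have hδK : 0 ≤ δ * K := by positivity
  have hδκ : 0 ≤ δ * (p * κ) := by positivity
  have hδp : 0 ≤ δ * p := by positivity
  have hδD' : δ * 2 ^ ℓ + δ * K + δ * (p * κ) + δ * p ≤ 1 / 1000 := by
    rw [hD] at hδD; linarith
  have hδℓ : δ * (ℓ + 1) ≤ δ * 2 ^ ℓ := mul_le_mul_of_nonneg_left h2ℓ hδ0.le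
  have hδ1 : 2 * δ ≤ δ * (ℓ + 1) := by nlinarith
  set n : ℝ := ((2 ^ ℓ * m : ℕ) : ℝ) with hn
  have hn' : n = 2 ^ ℓ * m := by rw [hn]; push_cast; rfl
  have hn2m : 2 * m ≤ n := by rw [hn']; exact mul_le_mul_of_nonneg_right (by linarith) (by linarith)
  have hn0 : 0 < n := by linarith
  have hnu : n * u ≤ 11 / 10 * ε := by
    have h1 : u ≤ (1 + K * δ) * (ε / n) := hfirst
    have h2 : n * u ≤ (1 + K * δ) * ε := by
      calc n * u ≤ n * ((1 + K * δ) * (ε / n)) := mul_le_mul_of_nonneg_left h1 hn0.le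
        _ = _ := by field_simp
    exact h2.trans (mul_le_mul_of_nonneg_right (by linarith) hε.le)
  have hmu : m * u ≤ 3 / 5 * ε := by
    have := mul_le_mul_of_nonneg_right hn2m hu.le
    linarith
  have humu : u ≤ m * u := by nlinarith
  have huε : u ≤ 3 / 5 * ε := humu.trans hmu
  -- only blocks of at most half the order of the matrix are multiplied or solved with
  have hgam : ∀ k < ℓ, gam u (2 ^ k * m) ≤ ε := by
    intro k hk
    have h1 : (2 : ℝ) ^ (k + 1) ≤ 2 ^ ℓ := pow_le_pow_right₀ (by norm_num) hk
    have h2 : 2 * ((2 ^ k * m : ℕ) : ℝ) ≤ n := by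
      rw [hn']; push_cast
      rw [pow_succ] at h1
      nlinarith
    have h3 := mul_le_mul_of_nonneg_right h2 hu.le
    unfold gam
    rw [div_le_iff₀ (by linarith)]
    nlinarith
  have hker : ∀ k < ℓ, f (2 ^ k * m) * u ≤ ε ∧ h (2 ^ k * m) * u ≤ ε := by
    intro k hk
    have h1 : 1 ≤ 2 ^ k * m := Nat.mul_pos (by positivity) hm
    have h2 : 2 ^ k * m ≤ 2 ^ ℓ * m :=
      Nat.mul_le_mul_right m (Nat.pow_le_pow_right (by norm_num) hk.le)
    exact ⟨(hfh _ h1 h2).1.trans (hgam k hk), (hfh _ h1 h2).2.trans (hgam k hk)⟩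
  have hεℓ : ε * 2 ^ ℓ ≤ 1 / 1000 :=
    (mul_le_mul_of_nonneg_right hεδ (by positivity)).trans (by linarith)
  have hfac := hLU.frob_sub_le hu.le huε hmu (by nlinarith) hker
  have hrep : frob (Hhat - H) ≤ 4 * ℓ * ε * frob H := by
    refine hHhat.frob_sub_le hℓ (by positivity) ?_ hu.le (fun v hv => (hP v hv).le) huε
      (by linarith) fun k h1 h2 => ⟨(hw k h1 h2).trans (by linarith), ?_⟩
    · have : p * κ * u ≤ p * κ * δ := mul_le_mul_of_nonneg_left (by linarith) hpκ
      linarith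
    · have := mul_le_mul_of_nonneg_left (hw k h1 h2) hp
      linarith
  refine ⟨Lhat * Uhat - H, by abel, ?_⟩
  unfold LeFirstOrder
  rw [zero_mul, add_zero, one_mul]
  have htri : frob (Lhat * Uhat - H) ≤ frob (Lhat * Uhat - Hhat) + frob (Hhat - H) := by
    simpa using frob_add_le (Lhat * Uhat - Hhat) (Hhat - H)
  have hHn : frob H ≤ frob Lhat * frob Uhat + frob (Lhat * Uhat - H) := by
    have h1 := frob_le_add_sub H (Lhat * Uhat)
    rw [frob_sub_comm] at h1
    exact h1.trans (add_le_add_left (frob_mul_le _ _) _)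
  rw [mul_assoc (11 * (2 ^ ℓ - 1) * ε)]
  set Λ := frob Lhat * frob Uhat
  have hΛ : 0 ≤ Λ := mul_nonneg (frob_nonneg _) (frob_nonneg _)
  have hη := frob_nonneg H
  set N : ℝ := 2 ^ ℓ - 1 with hN
  set ν : ℝ := N * ε with hν
  have hℓν : ℓ * ε ≤ ν := mul_le_mul_of_nonneg_right (by linarith) hε.le
  have hεν : ε ≤ ν := by nlinarith
  have hν1 : ν ≤ 1 / 1000 := by rw [hν, hN]; linarith
  have hfac' : frob (Lhat * Uhat - Hhat) ≤ 7 * ν * Λ :=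
    hfac.trans (mul_le_mul_of_nonneg_right (by linarith) hΛ)
  have hrep' : frob (Hhat - H) ≤ 4 * ν * frob H :=
    hrep.trans (mul_le_mul_of_nonneg_right (by linarith) hη)
  have hν0 : 0 ≤ ν := hε.le.trans hεν
  -- to first order `‖H‖` is at most `‖L‖ * ‖U‖`, which trades one term of the bound for the other
  have hHΛ : frob H ≤ 11 / 10 * Λ := by
    have h1 := mul_le_mul_of_nonneg_right hν1 hΛ
    have h2 := mul_le_mul_of_nonneg_right hν1 hη
    linarith
  have h3 := mul_le_mul_of_nonneg_left hHΛ hν0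
  have h4 : 0 ≤ ν * Λ := by positivity
  rw [mul_assoc 2 N ε, mul_assoc 11 N ε, ← hν]
  linarith
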